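/- Let $K$ be a field of characteristic $2$, let $\Lambda=\Lambda(x_i\mid i\ge 0)$ be the Grassmann algebra over $K$ in the odd letters $x_0,x_1,x_2,\dots$, and let $\partial_i$ be the superderivative of $\Lambda$ with $\partial_i(x_j)=\delta_{ij}$. Identify $x_i$ with the left multiplication by $x_i$ on $\Lambda$, and for $i\ge 0$ let $$v_i=\partial_i+x_ix_{i+1}\bigl(\partial_{i+3}+x_{i+3}x_{i+4}\bigl(\partial_{i+6}+x_{i+6}x_{i+7}(\partial_{i+9}+\cdots)\bigr)\bigr)\in\operatorname{End}\Lambda ,$$ a sum which is finite on each element of $\Lambda$. Let $\mathbf Q=\operatorname{Lie}(v_0,v_1,v_2)\subset\operatorname{End}\Lambda$ be the Lie superalgebra generated by the odd elements $v_0,v_1,v_2$, i.e. the smallest $\mathbb Z_2$-graded subspace containing them and closed under the supercommutator and under squares $a\mapsto a^2$ of odd elements. Let $\operatorname{Lie}_p(v_0,v_1,v_2)\subset\operatorname{End}\Lambda$, $p=2$, be the restricted Lie algebra generated by the same elements, i.e. the smallest subspace containing them and closed under the commutator and under $a\mapsto a^2$. Then $\mathbf Q=\operatorname{Lie}_p(v_0,v_1,v_2)$;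 this is a restricted Lie algebra with the $p$-mapping $a\mapsto a^{[2]}=a^2$; and this $p$-mapping is nil: for every $a\in\mathbf Q$ there is $n\ge 0$ with $a^{[2^n]}=0$, i.e. $a^{2^n}=0$ in $\operatorname{End}\Lambda$. -/

import Mathlib

open scoped TensorProduct

/-! An associative algebra is a Lie algebra under the commutator `⁅a, b⁆ = a * b - b * a`. -/
attribute [local instance] LieRing.ofAssociativeRing

noncomputable section

namespace FractalLie

/-! ### The Grassmann algebra in infinitely many variables and its superderivatives -/

/-- The Grassmann algebra `Λ = Λ(x_i | i ≥ 0)` over `K`. -/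
abbrev Grassmann (K : Type*) [Field K] : Type _ := ExteriorAlgebra K (ℕ →₀ K)

/-- The Grassmann letter `x_i`. -/
def gx (K : Type*) [Field K] (i : ℕ) : Grassmann K :=
  ExteriorAlgebra.ι K (Finsupp.single i (1 : K))

/-- The superderivative `∂_i` of `Λ` with `∂_i (x_j) = δ_{ij}`: the contraction with the `i`-th
coordinate functional, so that `∂_i (m * b) = m_i • b - m * ∂_i b` for `m = ∑ m_j x_j`. -/
def gd (K : Type*) [Field K] (i : ℕ) : Module.End K (Grassmann K) :=
  CliffordAlgebra.contractLeft (Q := (0 : QuadraticForm K (ℕ →₀ K)))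
    (Finsupp.lapply i : (ℕ →₀ K) →ₗ[K] K)

/-- The parity decomposition of `Λ`: `α = 0` is the even part, `α = 1` the odd part. -/
def gParity (K : Type*) [Field K] (α : ZMod 2) : Submodule K (Grassmann K) :=
  CliffordAlgebra.evenOdd (0 : QuadraticForm K (ℕ →₀ K)) α

/-- The parity decomposition of `End Λ`: the maps sending `Λ_β` to `Λ_{α+β}` for all `β`. -/
def endParity (K : Type*) [Field K] (α : ZMod 2) :
    Submodule K (Module.End K (Grassmann K)) where
  carrier := {φ | ∀ β : ZMod 2, ∀ f ∈ gParity K β, φ f ∈ gParity K (α + β)}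
  add_mem' ha hb β f hf := Submodule.add_mem _ (ha β f hf) (hb β f hf)
  zero_mem' _ _ _ := Submodule.zero_mem _
  smul_mem' c _ ha β f hf := Submodule.smul_mem _ c (ha β f hf)

/-- Each element of `Λ` involves finitely many letters, hence is killed by almost all `∂_i`. -/
theorem finite_gd_ne_zero (K : Type*) [Field K] (f : Grassmann K) :
    {i : ℕ | gd K i f ≠ 0}.Finite := by
  induction f using CliffordAlgebra.left_induction with
  | algebraMap r =>
    refine Set.Finite.subset Set.finite_empty fun i hi => hi ?_
    exact CliffordAlgebra.contractLeft_algebraMap _ _ r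
  | add a b ha hb =>
    refine (ha.union hb).subset fun i hi => ?_
    by_contra h
    simp only [Set.mem_union, Set.mem_ofPred_eq, not_or, not_not] at h
    exact hi (by rw [map_add, h.1, h.2, add_zero])
  | ι_mul a m ha =>
    refine (ha.union m.support.finite_toSet).subset fun i hi => ?_
    by_contra h
    simp only [Set.mem_union, Set.mem_ofPred_eq, not_or, not_not, Finset.mem_coe,
      Finsupp.mem_support_iff] at h
    refine hi ((CliffordAlgebra.contractLeft_ι_mul _ _ _).trans ?_)
    have h1 : (CliffordAlgebra.contractLeft (Q := (0 : QuadraticForm K (ℕ →₀ K)))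
      (Finsupp.lapply i : (ℕ →₀ K) →ₗ[K] K)) a = 0 := h.1
    rw [h1, Finsupp.lapply_apply, h.2, zero_smul, mul_zero, sub_zero]

/-! ### The pivot elements -/

/-- The coefficient `x_i x_{i+1} x_{i+3} x_{i+4} ⋯ x_{i+3l-3} x_{i+3l-2}` of `∂_{i+3l}` in `v_i`. -/
def pivotCoeff (K : Type*) [Field K] (i : ℕ) : ℕ → Grassmann K
  | 0 => 1
  | l + 1 => pivotCoeff K i l * (gx K (i + 3 * l) * gx K (i + 3 * l + 1))

theorem finite_pivot_support (K : Type*) [Field K] (i : ℕ) (f : Grassmann K) :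
    (Function.support fun l : ℕ => pivotCoeff K i l * gd K (i + 3 * l) f).Finite := by
  refine Set.Finite.subset (Set.Finite.preimage (f := fun l : ℕ => i + 3 * l)
    (fun a _ b _ h => by simpa using h) (finite_gd_ne_zero K f)) fun l hl h => hl ?_
  simp only [h, mul_zero]

/-- The pivot element
`v_i = ∂_i + x_i x_{i+1} (∂_{i+3} + x_{i+3} x_{i+4} (∂_{i+6} + ⋯))`, acting on `Λ`;
on every element of `Λ` only finitely many summands are nonzero. -/
def pivot (K : Type*) [Field K] (i : ℕ) : Module.End K (Grassmann K) where
  toFun f := ∑ᶠ l : ℕ, pivotCoeff K i l * gd K (i + 3 * l) f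
  map_add' f g := by
    simp only [map_add, mul_add]
    exact finsum_add_distrib (finite_pivot_support K i f) (finite_pivot_support K i g)
  map_smul' c f := by
    simp only [map_smul, mul_smul_comm, RingHom.id_apply]
    exact (smul_finsum' c (finite_pivot_support K i f)).symm

/-- The generators `v_0, v_1, v_2`. -/
def generators (K : Type*) [Field K] : Set (Module.End K (Grassmann K)) :=
  {pivot K 0, pivot K 1, pivot K 2}

/-! ### The Lie superalgebra generated by a set of endomorphisms -/

/-- `S` is a subalgebra of the Lie superalgebra `(End Λ)^{(-)}`: a `ℤ/2`-graded subspace, closed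
under the supercommutator `[a, b] = a b - (-1)^{|a||b|} b a` of homogeneous elements and under
squares of odd elements (automatic unless the characteristic is `2`, as `[a, a] = 2 a²`). -/
structure IsLieSuperSubalgebra (K : Type*) [Field K]
    (S : Submodule K (Module.End K (Grassmann K))) : Prop where
  graded : ∀ a ∈ S, ∃ a₀ ∈ S ⊓ endParity K 0, ∃ a₁ ∈ S ⊓ endParity K 1, a = a₀ + a₁
  bracket_mem : ∀ α β : ZMod 2, ∀ a ∈ S ⊓ endParity K α, ∀ b ∈ S ⊓ endParity K β,
    a * b - (-1 : K) ^ (α.val * β.val) • (b * a) ∈ S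
  sq_mem : ∀ a ∈ S ⊓ endParity K 1, a ^ 2 ∈ S

/-- `Lie(X)`: the Lie superalgebra generated by `X ⊆ End Λ`. -/
def lieSuperClosure (K : Type*) [Field K] (X : Set (Module.End K (Grassmann K))) :
    Submodule K (Module.End K (Grassmann K)) :=
  sInf {S | X ⊆ (S : Set (Module.End K (Grassmann K))) ∧ IsLieSuperSubalgebra K S}

/-- The Lie superalgebra `Q = Lie(v_0, v_1, v_2)`. -/
def Q (K : Type*) [Field K] : Submodule K (Module.End K (Grassmann K)) :=
  lieSuperClosure K (generators K)

/-! ### Restricted Lie algebras -/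

/-- The linear map `L[t] → L`, `K[t] ⊗ L → L`, extracting the coefficient of `t^n`. -/
def lieCoeff (K L : Type*) [Field K] [LieRing L] [LieAlgebra K L] (n : ℕ) :
    Polynomial K ⊗[K] L →ₗ[K] L :=
  (TensorProduct.lid K L).toLinearMap ∘ₗ (Polynomial.lcoeff K n).rTensor L

/-- The element `s_i(x, y)`, `i ≥ 1`, of a Lie algebra over a field of characteristic `p`:
`i s_i(x, y)` is the coefficient of `t^{i-1}` in `ad(t x + y)^{p-1}(x) ∈ L[t]`
(to be used only for `1 ≤ i < p`, where `i` is invertible in `K`). -/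
def jacobsonS (K L : Type*) [Field K] [LieRing L] [LieAlgebra K L] (p i : ℕ) (x y : L) : L :=
  (i : K)⁻¹ • lieCoeff K L (i - 1)
    ((fun z : Polynomial K ⊗[K] L =>
      ⁅(Polynomial.X : Polynomial K) ⊗ₜ[K] x + (1 : Polynomial K) ⊗ₜ[K] y, z⁆)^[p - 1]
      ((1 : Polynomial K) ⊗ₜ[K] x))

/-- `φ` is a `p`-mapping on the Lie algebra `L` over `K`, i.e. `(L, φ)` is a restricted Lie
algebra. -/
structure IsPMapping (K L : Type*) [Field K] [LieRing L] [LieAlgebra K L] (p : ℕ) (φ : L → L) :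
    Prop where
  map_smul : ∀ (c : K) (x : L), φ (c • x) = c ^ p • φ x
  ad_map : ∀ x : L, LieAlgebra.ad K L (φ x) = LieAlgebra.ad K L x ^ p
  map_add : ∀ x y : L,
    φ (x + y) = φ x + φ y + ∑ i ∈ Finset.Ico 1 p, jacobsonS K L p i x y

/-- The `p`-mapping `φ` is nil: every `x` satisfies `x^{[p^n]} = 0` for some `n`. -/
def IsNilPMapping {L : Type*} [Zero L] (φ : L → L) : Prop :=
  ∀ x : L, ∃ n : ℕ, φ^[n] x = 0

/-- `Lie_p(X)`: the restricted Lie algebra generated by a subset `X` of an associative algebra `A`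
(with the commutator and the `p`-mapping `a ↦ a^p`). -/
def restrictedLieClosure (K : Type*) {A : Type*} [Field K] [Ring A] [Algebra K A] (p : ℕ)
    (X : Set A) : LieSubalgebra K A :=
  sInf {S | X ⊆ (S : Set A) ∧ ∀ a ∈ S, a ^ p ∈ S}

theorem pow_mem_restrictedLieClosure (K : Type*) {A : Type*} [Field K] [Ring A] [Algebra K A]
    (p : ℕ) (X : Set A) {a : A} (ha : a ∈ restrictedLieClosure K p X) :
    a ^ p ∈ restrictedLieClosure K p X := by
  rw [restrictedLieClosure, ← SetLike.mem_coe, LieSubalgebra.coe_sInf, Set.mem_iInter₂] at ha ⊢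
  exact fun S hS => hS.2 a (ha S hS)

/-- The `p`-mapping `a ↦ a^p` of `Lie_p(X)`. -/
def restrictedLieClosurePMap (K : Type*) {A : Type*} [Field K] [Ring A] [Algebra K A] (p : ℕ)
    (X : Set A) (a : restrictedLieClosure K p X) : restrictedLieClosure K p X :=
  ⟨(a : A) ^ p, pow_mem_restrictedLieClosure K p X a.2⟩

end FractalLie

end

/-!
In characteristic two, brackets and squares of the monomials `x^S v_n` are again such monomials or
zero: the basic relations are `v_n ^ 2 = x_{n+1} v_{n+3}`, `⁅v_n, v_{n+1}⁆ = x_n v_{n+3}` and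
`⁅v_n, x_n⁆ = 1`. Giving `v_n` the weight `(3/2)^n` and `x_n` the weight `-(3/2)^n`, all these
operations are subadditive for the weight.

Nilpotency is a contraction argument. A combination of monomials in the letters `x_i`, `i ≥ k`, has
the form `a = t ∂_k + b + x_k c`, where `b` and `c` do not involve `x_k`, and
`a² = (t c + b²) + x_k ⁅b, c⁆`. As `x_k` commutes with `b` and `c` and squares to zero, it
suffices that `t c + b²` is nilpotent; dropping `x_{k+1}` in the same way leaves a combination of
monomials in the letters `x_i`, `i ≥ k + 2`. The bound on the weight has doubled, but the least
weight of a monomial has been multiplied by `9/4 > 2`, so after finitely many steps nothing is left.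

The super and the restricted closure agree because both are spanned by monomials, which are
homogeneous, and every monomial `x^S v_n` with `S` nonempty, in particular every even one, squares
to zero.
-/

namespace FractalLie

section Associative

variable {A : Type*} [Ring A]

theorem lie_mul (a b c : A) : ⁅a, b * c⁆ = ⁅a, b⁆ * c + b * ⁅a, c⁆ := by
  simp only [LieRing.of_associative_ring_bracket]
  noncomm_ring

theorem mul_lie (a b c : A) : ⁅a * b, c⁆ = a * ⁅b, c⁆ + ⁅a, c⁆ * b := by
  simp only [LieRing.of_associative_ring_bracket]
  noncomm_ring

theorem lie_mul_of_commute {a b : A} (h : Commute a b) (c : A) : ⁅a, b * c⁆ = b * ⁅a, c⁆ := by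
  rw [lie_mul, h.lie_eq, zero_mul, zero_add]

theorem mul_lie_of_commute {a c : A} (h : Commute a c) (b : A) : ⁅a * b, c⁆ = a * ⁅b, c⁆ := by
  rw [mul_lie, h.lie_eq, zero_mul, add_zero]

theorem mul_sq_eq_zero {x c : A} (hx : x * x = 0) (hxc : Commute x c) : (x * c) ^ 2 = 0 := by
  rw [hxc.mul_pow, sq x, hx, zero_mul]

theorem exists_add_mul_pow_eq {y e f : A} (he : Commute y e) (hf : Commute y f)
    (N : ℕ) : ∃ g, Commute y g ∧ (e + y * f) ^ N = e ^ N + y * g := by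
  induction N with
  | zero => exact ⟨0, Commute.zero_right _, by simp⟩
  | succ N ih =>
    obtain ⟨g, hg, hN⟩ := ih
    refine ⟨e ^ N * f + g * (e + y * f),
      ((he.pow_right N).mul_right hf).add_right (hg.mul_right
        (he.add_right ((Commute.refl y).mul_right hf))), ?_⟩
    rw [pow_succ, hN, pow_succ, add_mul, mul_add (e ^ N), mul_add y, ← mul_assoc (e ^ N),
      ← (he.pow_right N).eq, mul_assoc y, mul_assoc y, add_assoc]

/-- `y` generates a square-zero ideal of its centralizer, so nilpotency is detected modulo `y`. -/
theorem isNilpotent_add_mul {y e f : A} (hy : y * y = 0) (he : Commute y e) (hf : Commute y f)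
    (h : IsNilpotent e) : IsNilpotent (e + y * f) := by
  obtain ⟨N, hN⟩ := h
  obtain ⟨g, hg, hpow⟩ := exists_add_mul_pow_eq he hf N
  refine IsNilpotent.of_pow (m := N) ⟨2, ?_⟩
  rw [hpow, hN, zero_add, mul_sq_eq_zero hy hg]

variable [CharP A 2]

theorem lie_swap_of_charTwo (a b : A) : ⁅a, b⁆ = ⁅b, a⁆ := by
  rw [← lie_skew, CharTwo.neg_eq]

theorem lie_lie_self_of_charTwo (a b : A) : ⁅a, ⁅a, b⁆⁆ = ⁅a ^ 2, b⁆ := by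
  rw [sq, mul_lie, LieRing.of_associative_ring_bracket, CharTwo.sub_eq_add]

theorem add_sq_of_charTwo (a b : A) : (a + b) ^ 2 = a ^ 2 + b ^ 2 + ⁅a, b⁆ := by
  rw [LieRing.of_associative_ring_bracket, CharTwo.sub_eq_add]
  noncomm_ring

theorem add_add_mul_sq {x d b c : A} (hx : x * x = 0) (hd : d ^ 2 = 0) (hxb : Commute x b)
    (hdb : Commute d b) (hxc : Commute x c) (hdc : Commute d c) :
    (d + b + x * c) ^ 2 = ⁅d, x⁆ * c + b ^ 2 + x * ⁅b, c⁆ := by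
  have hlie : ⁅d + b, x * c⁆ = ⁅d, x⁆ * c + x * ⁅b, c⁆ := by
    rw [add_lie, lie_mul, hdc.lie_eq, lie_mul_of_commute hxb.symm, mul_zero, add_zero]
  rw [add_sq_of_charTwo, add_sq_of_charTwo, hd, hdb.lie_eq, mul_sq_eq_zero hx hxc, hlie]
  abel

end Associative

section Span

variable {K : Type*} [Field K]

theorem lie_mem_of_mem_span {L : Type*} [LieRing L] [LieAlgebra K L] {s t : Set L}
    {N : Submodule K L} (h : ∀ a ∈ s, ∀ b ∈ t, ⁅a, b⁆ ∈ N) {a b : L}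
    (ha : a ∈ Submodule.span K s) (hb : b ∈ Submodule.span K t) : ⁅a, b⁆ ∈ N := by
  have hle : Submodule.map₂ (LieAlgebra.ad K L).toLinearMap (Submodule.span K s)
      (Submodule.span K t) ≤ N := by
    rw [Submodule.map₂_span_span, Submodule.span_le, Set.image2_subset_iff]
    exact h
  exact hle (Submodule.apply_mem_map₂ _ ha hb)

theorem mem_span_of_mem_insert_zero {V : Type*} [AddCommGroup V] [Module K V] {s : Set V} {a : V}
    (ha : a ∈ insert 0 s) : a ∈ Submodule.span K s :=
  Submodule.span_insert_zero.le (Submodule.subset_span ha)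

variable {A : Type*} [Ring A] [Algebra K A]

theorem commute_of_mem_span {a : A} {s : Set A} (h : ∀ b ∈ s, Commute a b) {b : A}
    (hb : b ∈ Submodule.span K s) : Commute a b := by
  have hle : Submodule.span K s ≤ (Subalgebra.centralizer K {a}).toSubmodule :=
    Submodule.span_le.2 fun b hb => Set.mem_centralizer_iff.2 fun _ hg => hg ▸ (h b hb).eq
  exact Set.mem_centralizer_iff.1 (hle hb) a rfl

variable [CharP A 2]

theorem sq_mem_of_mem_span {s : Set A} {N : Submodule K A} (hsq : ∀ a ∈ s, a ^ 2 ∈ N)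
    (hlie : ∀ a ∈ s, ∀ b ∈ s, ⁅a, b⁆ ∈ N) {a : A} (ha : a ∈ Submodule.span K s) : a ^ 2 ∈ N := by
  induction ha using Submodule.span_induction with
  | mem a ha => exact hsq a ha
  | zero => simp
  | add a b ha hb iha ihb =>
    rw [add_sq_of_charTwo]
    exact add_mem (add_mem iha ihb) (lie_mem_of_mem_span hlie ha hb)
  | smul c a _ ih =>
    rw [smul_pow]
    exact N.smul_mem _ ih

theorem restrictedLieClosure_le_span {s X : Set A} (hX : X ⊆ s)
    (hlie : ∀ a ∈ s, ∀ b ∈ s, ⁅a, b⁆ ∈ Submodule.span K s)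
    (hsq : ∀ a ∈ s, a ^ 2 ∈ Submodule.span K s) :
    (restrictedLieClosure K 2 X).toSubmodule ≤ Submodule.span K s := by
  let L : LieSubalgebra K A :=
    { Submodule.span K s with lie_mem' := fun ha hb => lie_mem_of_mem_span hlie ha hb }
  have hL : restrictedLieClosure K 2 X ≤ L :=
    sInf_le ⟨hX.trans Submodule.subset_span, fun _ ha => sq_mem_of_mem_span hsq hlie ha⟩
  exact hL

theorem restrictedLieClosure_le_span_inter {B X : Set A} {S : Submodule K A} (hXB : X ⊆ B)
    (hXS : X ⊆ S) (hlieB : ∀ a ∈ B, ∀ b ∈ B, ⁅a, b⁆ ∈ insert 0 B)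
    (hsqB : ∀ a ∈ B, a ^ 2 ∈ insert 0 B) (hlieS : ∀ a ∈ B ∩ S, ∀ b ∈ B ∩ S, ⁅a, b⁆ ∈ S)
    (hsqS : ∀ a ∈ B ∩ S, a ^ 2 ∈ S) :
    (restrictedLieClosure K 2 X).toSubmodule ≤ Submodule.span K (B ∩ S) := by
  have mem_span : ∀ a ∈ insert 0 B, a ∈ S → a ∈ Submodule.span K (B ∩ S) := by
    rintro a (rfl | haB) haS
    · exact zero_mem _
    · exact Submodule.subset_span ⟨haB, haS⟩
  exact restrictedLieClosure_le_span (fun a ha => ⟨hXB ha, hXS ha⟩)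
    (fun a ha b hb => mem_span _ (hlieB a ha.1 b hb.1) (hlieS a ha b hb))
    (fun a ha => mem_span _ (hsqB a ha.1) (hsqS a ha))

end Span

section RestrictedLieClosure

variable {K A : Type*} [Field K] [Ring A] [Algebra K A]

theorem subset_restrictedLieClosure (p : ℕ) (X : Set A) :
    X ⊆ (restrictedLieClosure K p X : Set A) := by
  rw [restrictedLieClosure, LieSubalgebra.coe_sInf]
  exact Set.subset_iInter₂ fun S hS => hS.1

theorem jacobsonS_two_one {L : Type*} [LieRing L] [LieAlgebra K L] (x y : L) :
    jacobsonS K L 2 1 x y = ⁅y, x⁆ := by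
  have hlie : ⁅(Polynomial.X : Polynomial K) ⊗ₜ[K] x + (1 : Polynomial K) ⊗ₜ[K] y,
      (1 : Polynomial K) ⊗ₜ[K] x⁆ = (1 : Polynomial K) ⊗ₜ[K] ⁅y, x⁆ := by
    refine (add_lie (L := Polynomial K ⊗[K] L) (M := Polynomial K ⊗[K] L) _ _ _).trans ?_
    rw [LieAlgebra.ExtendScalars.bracket_tmul, LieAlgebra.ExtendScalars.bracket_tmul, lie_self,
      TensorProduct.tmul_zero, zero_add, mul_one]
  simp [jacobsonS, lieCoeff, hlie]

theorem isPMapping_restrictedLieClosurePMap_two [CharP A 2] (X : Set A) :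
    IsPMapping K (restrictedLieClosure K 2 X) 2 (restrictedLieClosurePMap K 2 X) where
  map_smul c a := Subtype.ext (smul_pow c (a : A) 2)
  ad_map a := LinearMap.ext fun b => Subtype.ext (lie_lie_self_of_charTwo (a : A) b).symm
  map_add a b := by
    have hIco : Finset.Ico 1 2 = {1} := rfl
    rw [hIco, Finset.sum_singleton, jacobsonS_two_one]
    refine Subtype.ext ((add_sq_of_charTwo (a : A) b).trans ?_)
    rw [lie_swap_of_charTwo (a : A)]
    rfl

theorem isNilPMapping_of_isNilpotent {p : ℕ} (hp : 1 < p) {X : Set A}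
    (h : ∀ a ∈ restrictedLieClosure K p X, IsNilpotent a) :
    IsNilPMapping (restrictedLieClosurePMap K p X) := by
  intro a
  have coe_iterate (n : ℕ) :
      (((restrictedLieClosurePMap K p X)^[n] a : restrictedLieClosure K p X) : A)
        = (a : A) ^ p ^ n := by
    induction n with
    | zero => simp
    | succ n ih =>
      rw [Function.iterate_succ_apply', pow_succ, pow_mul, ← ih]
      rfl
  obtain ⟨N, hN⟩ := h a a.2
  refine ⟨N, Subtype.ext ?_⟩
  rw [coe_iterate]
  exact pow_eq_zero_of_le (Nat.lt_pow_self hp).le hN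

end RestrictedLieClosure

section Weights

/-- The weight `(3/2) ^ n` of the pivot `v_n`; the letter `x_n` has the opposite weight. The base
`r = 3/2` satisfies `r ^ 3 ≤ r + 2`, so that brackets and squares of monomials do not increase the
weight, `1 ≤ r ^ 2 * (r - 1)`, so that the monomials have positive weight, and `2 < r ^ 2`, so that
the weights of the pivots `v_0, v_2, v_4, …` grow faster than those of iterated squares. -/
def pivotWeight (n : ℕ) : ℚ := (3 / 2) ^ n

/-- The weight of the monomial `x^S v_n`. -/
def monomialWeight (S : Finset ℕ) (n : ℕ) : ℚ := pivotWeight n - ∑ i ∈ S, pivotWeight i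

theorem pivotWeight_succ (n : ℕ) : pivotWeight (n + 1) = 3 / 2 * pivotWeight n :=
  pow_succ' _ n

theorem pivotWeight_pos (n : ℕ) : 0 < pivotWeight n := by
  unfold pivotWeight
  positivity

theorem pivotWeight_mono : Monotone pivotWeight := pow_right_mono₀ (by norm_num)

theorem pivotWeight_add_three_le (n : ℕ) :
    pivotWeight (n + 3) ≤ pivotWeight (n + 1) + 2 * pivotWeight n := by
  linarith [pivotWeight_succ n, pivotWeight_succ (n + 1), pivotWeight_succ (n + 2),
    pivotWeight_pos n]

theorem monomialWeight_empty (n : ℕ) : monomialWeight ∅ n = pivotWeight n := by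
  simp [monomialWeight]

theorem monomialWeight_insert {i : ℕ} {S : Finset ℕ} (hi : i ∉ S) (n : ℕ) :
    monomialWeight (insert i S) n = monomialWeight S n - pivotWeight i := by
  rw [monomialWeight, Finset.sum_insert hi, monomialWeight]
  ring

theorem monomialWeight_erase {i : ℕ} {S : Finset ℕ} (hi : i ∈ S) (n : ℕ) :
    monomialWeight (S.erase i) n = monomialWeight S n + pivotWeight i := by
  rw [monomialWeight, Finset.sum_erase_eq_sub hi, monomialWeight]
  ring

theorem sum_Ico_pivotWeight {k m : ℕ} (h : k ≤ m) :
    ∑ i ∈ Finset.Ico k m, pivotWeight i = 2 * pivotWeight m - 2 * pivotWeight k := by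
  induction m, h using Nat.le_induction with
  | base => simp
  | succ m hkm ih =>
    rw [Finset.sum_Ico_succ_top hkm, ih, pivotWeight_succ]
    ring

/-- The monomials `x^S v_n` in the letters `x_i`, `i ≥ k`, with `S ⊆ [k, n - 3]`. -/
def IsRegular (k : ℕ) (S : Finset ℕ) (n : ℕ) : Prop := ∀ i ∈ S, k ≤ i ∧ i + 3 ≤ n

/-- The monomials that occur in `Lie(v_k, v_{k+1}, …)`: besides the regular ones there are the
`x_j v_{j+2}`, which arise as the squares of the pivots. -/
def IsAdmissible (k : ℕ) (S : Finset ℕ) (n : ℕ) : Prop :=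
  IsRegular k S n ∨ ∃ j, k ≤ j ∧ S = {j} ∧ n = j + 2

variable {k n i : ℕ} {S : Finset ℕ}

theorem isRegular_empty (k n : ℕ) : IsRegular k ∅ n := by simp [IsRegular]

theorem IsRegular.insert (h : IsRegular k S n) (hk : k ≤ i) (hn : i + 3 ≤ n) :
    IsRegular k (insert i S) n :=
  (Finset.forall_mem_insert _ _ _).2 ⟨⟨hk, hn⟩, h⟩

theorem IsAdmissible.le (h : IsAdmissible k S n) (hi : i ∈ S) : k ≤ i ∧ i + 2 ≤ n := by
  obtain h | ⟨j, hkj, rfl, rfl⟩ := h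
  · exact ⟨(h i hi).1, (Nat.le_succ _).trans (h i hi).2⟩
  · obtain rfl := Finset.mem_singleton.1 hi
    exact ⟨hkj, le_rfl⟩

theorem IsAdmissible.isRegular_of_lt (h : IsAdmissible k S n) {m : ℕ} (hm : n < m) :
    IsRegular k S m := fun _ hi => ⟨(h.le hi).1, by have := (h.le hi).2; lia⟩

theorem IsAdmissible.isRegular_erase (h : IsAdmissible k S n) (hi : i ∈ S) :
    IsRegular k (S.erase i) n := by
  obtain h | ⟨j, -, rfl, rfl⟩ := h
  · exact fun l hl => h l (Finset.mem_of_mem_erase hl)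
  · obtain rfl := Finset.mem_singleton.1 hi
    simpa using isRegular_empty k (i + 2)

theorem IsRegular.succ_of_notMem (h : IsRegular k S n) (hk : k ∉ S) : IsRegular (k + 1) S n :=
  fun _ hi => ⟨(h _ hi).1.lt_of_ne fun hki => hk (hki ▸ hi), (h _ hi).2⟩

theorem IsAdmissible.succ_of_notMem (h : IsAdmissible k S n) (hk : k ∉ S) :
    IsAdmissible (k + 1) S n := by
  obtain h | ⟨j, hkj, rfl, rfl⟩ := h
  · exact .inl (h.succ_of_notMem hk)
  · exact .inr ⟨j, hkj.lt_of_ne fun hkj => hk (hkj ▸ Finset.mem_singleton_self k), rfl, rfl⟩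

theorem IsRegular.pivotWeight_le_monomialWeight (h : IsRegular k S n) (hkn : k ≤ n) :
    pivotWeight k ≤ monomialWeight S n := by
  obtain rfl | ⟨i, hi⟩ := S.eq_empty_or_nonempty
  · rw [monomialWeight_empty]
    exact pivotWeight_mono hkn
  obtain ⟨m, rfl⟩ : ∃ m, n = m + 2 := ⟨n - 2, by have := (h i hi).2; lia⟩
  have hkm : k ≤ m := by have := h i hi; lia
  have hsum : ∑ i ∈ S, pivotWeight i ≤ ∑ i ∈ Finset.Ico k m, pivotWeight i :=
    Finset.sum_le_sum_of_subset_of_nonneg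
      (fun i hi => Finset.mem_Ico.2 ⟨(h i hi).1, by have := (h i hi).2; lia⟩)
      fun i _ _ => (pivotWeight_pos i).le
  rw [sum_Ico_pivotWeight hkm] at hsum
  rw [monomialWeight]
  linarith [pivotWeight_succ m, pivotWeight_succ (m + 1), pivotWeight_pos m, pivotWeight_pos k]

theorem IsAdmissible.pivotWeight_le_monomialWeight (h : IsAdmissible k S n) (hkn : k ≤ n) :
    pivotWeight k ≤ monomialWeight S n := by
  obtain h | ⟨j, hkj, rfl, rfl⟩ := h
  · exact h.pivotWeight_le_monomialWeight hkn
  · rw [monomialWeight, Finset.sum_singleton]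
    linarith [pivotWeight_succ j, pivotWeight_succ (j + 1), pivotWeight_pos j,
      pivotWeight_mono hkj]

end Weights

/-- Elements of a ring behaving like the letters `x_i`, the superderivatives `∂_i` and the pivots
`v_i` do in characteristic two, where supercommutators are commutators. -/
structure PivotSystem (A : Type*) [Ring A] where
  x : ℕ → A
  d : ℕ → A
  v : ℕ → A
  commute_x_x (i j : ℕ) : Commute (x i) (x j)
  x_mul_self (i : ℕ) : x i * x i = 0
  d_sq (i : ℕ) : d i ^ 2 = 0
  lie_d_x (i : ℕ) : ⁅d i, x i⁆ = 1
  commute_d_x {i j : ℕ} : i ≠ j → Commute (d i) (x j)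
  v_eq (i : ℕ) : v i = d i + x i * (x (i + 1) * v (i + 3))
  commute_x_v {i n : ℕ} : i < n → Commute (x i) (v n)
  commute_d_v {i n : ℕ} : i < n → Commute (d i) (v n)

namespace PivotSystem

section Pivots

variable {A : Type*} [Ring A] (P : PivotSystem A)

theorem lie_v_of_commute {n : ℕ} {y : A} (hx : Commute (P.x n) y) (hd : Commute (P.d n) y) :
    ⁅P.v n, y⁆ = P.x n * ⁅P.x (n + 1) * P.v (n + 3), y⁆ := by
  rw [P.v_eq, add_lie, hd.lie_eq, zero_add, mul_lie_of_commute hx]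

theorem x_mul_lie_v {n : ℕ} {y : A} (hx : Commute (P.x n) y) (hd : Commute (P.d n) y) :
    P.x n * ⁅P.v n, y⁆ = 0 := by
  rw [P.lie_v_of_commute hx hd, ← mul_assoc, P.x_mul_self, zero_mul]

theorem lie_v_x (n : ℕ) : ⁅P.v n, P.x n⁆ = 1 := by
  have htail : Commute (P.x n * (P.x (n + 1) * P.v (n + 3))) (P.x n) :=
    (P.commute_x_x n n).mul_left
      ((P.commute_x_x (n + 1) n).mul_left (P.commute_x_v (by lia)).symm)
  rw [P.v_eq, add_lie, P.lie_d_x, htail.lie_eq, add_zero]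

theorem lie_v_x_mul {n : ℕ} {y : A} (hx : Commute (P.x n) y) (hd : Commute (P.d n) y) :
    ⁅P.v n, P.x n * y⁆ = y := by
  rw [lie_mul, P.lie_v_x, one_mul, P.x_mul_lie_v hx hd, add_zero]

variable [CharP A 2]

theorem v_sq (n : ℕ) : P.v n ^ 2 = P.x (n + 1) * P.v (n + 3) := by
  have hx : Commute (P.x n) (P.x (n + 1) * P.v (n + 3)) :=
    (P.commute_x_x _ _).mul_right (P.commute_x_v (by lia))
  have hd : Commute (P.d n) (P.x (n + 1) * P.v (n + 3)) :=
    (P.commute_d_x (by lia)).mul_right (P.commute_d_v (by lia))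
  have hsq := add_add_mul_sq (P.x_mul_self n) (P.d_sq n) (Commute.zero_right _)
    (Commute.zero_right _) hx hd
  simpa [← P.v_eq, P.lie_d_x] using hsq

theorem lie_v_v_succ (n : ℕ) : ⁅P.v n, P.v (n + 1)⁆ = P.x n * P.v (n + 3) := by
  have hzero : P.x (n + 1) * ⁅P.v (n + 3), P.v (n + 1)⁆ = 0 := by
    rw [lie_swap_of_charTwo]
    exact P.x_mul_lie_v (P.commute_x_v (by lia)) (P.commute_d_v (by lia))
  rw [P.lie_v_of_commute (P.commute_x_v n.lt_succ_self) (P.commute_d_v n.lt_succ_self), mul_lie,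
    hzero, zero_add, lie_swap_of_charTwo, P.lie_v_x, one_mul]

end Pivots

section Monomials

variable {A : Type*} [Ring A] (P : PivotSystem A)

/-- The product `x^S` of the letters `x_i`, `i ∈ S`. -/
def xprod (S : Finset ℕ) : A := S.noncommProd P.x fun i _ j _ _ => P.commute_x_x i j

/-- The monomial `x^S v_n`. -/
def monomial (S : Finset ℕ) (n : ℕ) : A := P.xprod S * P.v n

theorem xprod_empty : P.xprod ∅ = 1 := Finset.noncommProd_empty _ _

theorem xprod_insert {i : ℕ} {S : Finset ℕ} (hi : i ∉ S) :
    P.xprod (insert i S) = P.x i * P.xprod S :=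
  Finset.noncommProd_insert_of_notMem _ _ _ _ hi

theorem commute_xprod {S : Finset ℕ} {a : A} (h : ∀ i ∈ S, Commute a (P.x i)) :
    Commute a (P.xprod S) :=
  Finset.noncommProd_commute _ _ _ _ h

theorem monomial_empty (n : ℕ) : P.monomial ∅ n = P.v n := by
  rw [monomial, xprod_empty, one_mul]

theorem monomial_insert {i : ℕ} {S : Finset ℕ} (hi : i ∉ S) (n : ℕ) :
    P.monomial (insert i S) n = P.x i * P.monomial S n := by
  rw [monomial, P.xprod_insert hi, mul_assoc, monomial]

theorem monomial_singleton (i n : ℕ) : P.monomial {i} n = P.x i * P.v n := by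
  rw [← LawfulSingleton.insert_empty_eq, P.monomial_insert (Finset.notMem_empty i),
    P.monomial_empty]

theorem monomial_eq_x_mul_erase {i : ℕ} {S : Finset ℕ} (hi : i ∈ S) (n : ℕ) :
    P.monomial S n = P.x i * P.monomial (S.erase i) n := by
  rw [← P.monomial_insert (Finset.notMem_erase i S), Finset.insert_erase hi]

theorem x_mul_monomial_of_mem {i : ℕ} {S : Finset ℕ} (hi : i ∈ S) (n : ℕ) :
    P.x i * P.monomial S n = 0 := by
  rw [P.monomial_eq_x_mul_erase hi, ← mul_assoc, P.x_mul_self, zero_mul]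

theorem commute_x_monomial {i n : ℕ} (hi : i < n) (S : Finset ℕ) :
    Commute (P.x i) (P.monomial S n) :=
  (P.commute_xprod fun j _ => P.commute_x_x i j).mul_right (P.commute_x_v hi)

theorem commute_d_monomial {i n : ℕ} {S : Finset ℕ} (hi : i < n) (hS : i ∉ S) :
    Commute (P.d i) (P.monomial S n) :=
  (P.commute_xprod fun _ hj => P.commute_d_x (ne_of_mem_of_not_mem hj hS).symm).mul_right
    (P.commute_d_v hi)

theorem monomial_sq_eq_zero {S : Finset ℕ} {n : ℕ} (hS : S.Nonempty) (h : ∀ i ∈ S, i < n) :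
    P.monomial S n ^ 2 = 0 := by
  obtain ⟨i, hi⟩ := hS
  rw [P.monomial_eq_x_mul_erase hi]
  exact mul_sq_eq_zero (P.x_mul_self i) (P.commute_x_monomial (h i hi) _)

theorem lie_v_monomial_of_lt {S : Finset ℕ} {n : ℕ} (h : ∀ i ∈ S, i < n) (m : ℕ) :
    ⁅P.v n, P.monomial S m⁆ = P.xprod S * ⁅P.v n, P.v m⁆ :=
  lie_mul_of_commute (P.commute_xprod fun _ hi => (P.commute_x_v (h _ hi)).symm) _

theorem xprod_mul_x_mul_v {S : Finset ℕ} {i : ℕ} (hi : i ∉ S) (n : ℕ) :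
    P.xprod S * (P.x i * P.v n) = P.monomial (insert i S) n := by
  rw [P.monomial_insert hi, monomial, ← mul_assoc, ← mul_assoc,
    (P.commute_xprod fun j _ => P.commute_x_x i j).eq]

end Monomials

section Products

variable {A : Type*} [Ring A] (P : PivotSystem A)

/-- The regular monomials `x^S v_n` of weight at most `W` in the letters `x_i`, `i ≥ k`, with
`n ≥ q`. -/
def regularMonomialsLE (k q : ℕ) (W : ℚ) : Set A :=
  {a | ∃ S n, q ≤ n ∧ IsRegular k S n ∧ monomialWeight S n ≤ W ∧ P.monomial S n = a}

/-- The admissible monomials `x^S v_n` of weight at most `W` in the letters `x_i`, `i ≥ k`, with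
`n ≥ q`. -/
def monomialsLE (k q : ℕ) (W : ℚ) : Set A :=
  {a | ∃ S n, q ≤ n ∧ IsAdmissible k S n ∧ monomialWeight S n ≤ W ∧ P.monomial S n = a}

variable {P} {k q q' : ℕ} {W W' : ℚ}

theorem regularMonomialsLE_mono (hq : q' ≤ q) (hW : W ≤ W') :
    P.regularMonomialsLE k q W ⊆ P.regularMonomialsLE k q' W' := by
  rintro _ ⟨S, n, hn, hS, hSW, rfl⟩
  exact ⟨S, n, hq.trans hn, hS, hSW.trans hW, rfl⟩

theorem monomialsLE_mono (hq : q' ≤ q) (hW : W ≤ W') :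
    P.monomialsLE k q W ⊆ P.monomialsLE k q' W' := by
  rintro _ ⟨S, n, hn, hS, hSW, rfl⟩
  exact ⟨S, n, hq.trans hn, hS, hSW.trans hW, rfl⟩

theorem regularMonomialsLE_subset_monomialsLE :
    P.regularMonomialsLE k q W ⊆ P.monomialsLE k q W := by
  rintro _ ⟨S, n, hn, hS, hSW, rfl⟩
  exact ⟨S, n, hn, .inl hS, hSW, rfl⟩

theorem x_mul_mem_regularMonomialsLE {i : ℕ} (hk : k ≤ i) (hq : i + 3 ≤ q) {a : A}
    (ha : a ∈ insert 0 (P.regularMonomialsLE k q W)) :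
    P.x i * a ∈ insert 0 (P.regularMonomialsLE k q (W - pivotWeight i)) := by
  obtain rfl | ⟨S, n, hn, hS, hSW, rfl⟩ := ha
  · exact .inl (mul_zero _)
  by_cases hi : i ∈ S
  · exact .inl (P.x_mul_monomial_of_mem hi n)
  · exact .inr ⟨insert i S, n, hn, hS.insert hk (hq.trans hn),
      (monomialWeight_insert hi n).trans_le (sub_le_sub_right hSW _), P.monomial_insert hi n⟩

theorem xprod_mul_mem_regularMonomialsLE {S : Finset ℕ} (hS : IsRegular k S q) {a : A}
    (ha : a ∈ insert 0 (P.regularMonomialsLE k q W)) :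
    P.xprod S * a ∈ insert 0 (P.regularMonomialsLE k q (W - ∑ i ∈ S, pivotWeight i)) := by
  induction S using Finset.induction_on with
  | empty => simpa only [xprod_empty, one_mul, Finset.sum_empty, sub_zero] using ha
  | insert i S hi ih =>
    obtain ⟨⟨hki, hiq⟩, hS⟩ := (Finset.forall_mem_insert _ _ _).1 hS
    rw [P.xprod_insert hi, mul_assoc, Finset.sum_insert hi, add_comm, ← sub_sub]
    exact x_mul_mem_regularMonomialsLE hki hiq (ih hS)

theorem lie_v_monomial_mem_of_add_two_le {n m : ℕ} {T : Finset ℕ} (hkn : k ≤ n) (hnm : n + 2 ≤ m)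
    (hnT : n ∉ T)
    (ih : ⁅P.v (n + 3), P.monomial T m⁆ ∈ insert 0
      (P.regularMonomialsLE k (n + 5) (pivotWeight (n + 3) + monomialWeight T m))) :
    ⁅P.v n, P.monomial T m⁆ ∈ insert 0
      (P.regularMonomialsLE k (n + 2) (pivotWeight n + monomialWeight T m)) := by
  rw [P.lie_v_of_commute (P.commute_x_monomial (by lia) T) (P.commute_d_monomial (by lia) hnT),
    mul_lie_of_commute (P.commute_x_monomial (by lia) T)]
  refine Set.insert_subset_insert (regularMonomialsLE_mono (by lia) ?_)
    (x_mul_mem_regularMonomialsLE hkn (by lia)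
      (x_mul_mem_regularMonomialsLE (i := n + 1) (by lia) (by lia) ih))
  linarith [pivotWeight_add_three_le n]

variable [CharP A 2]

theorem lie_v_monomial_mem {n m : ℕ} {T : Finset ℕ} (hkn : k ≤ n) (hkm : k ≤ m) (hnm : n ≤ m + 1)
    (hT : IsAdmissible k T m) :
    ⁅P.v n, P.monomial T m⁆ ∈ insert 0
      (P.regularMonomialsLE k (n + 2) (pivotWeight n + monomialWeight T m)) := by
  have hTlt {i : ℕ} (hi : i ∈ T) : i + 2 ≤ m := (hT.le hi).2
  by_cases hnT : n ∈ T
  · refine .inr ⟨T.erase n, m, hTlt hnT, hT.isRegular_erase hnT, ?_, ?_⟩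
    · rw [monomialWeight_erase hnT, add_comm]
    · have hnm : n < m := by have := hTlt hnT; lia
      rw [P.monomial_eq_x_mul_erase hnT, P.lie_v_x_mul (P.commute_x_monomial hnm _)
        (P.commute_d_monomial hnm (Finset.notMem_erase n T))]
  obtain rfl | rfl | rfl | hnm : n = m + 1 ∨ n = m ∨ m = n + 1 ∨ n + 2 ≤ m := by lia
  · have hmT : m ∉ T := fun h => by have := hTlt h; lia
    refine .inr ⟨insert m T, m + 3, le_rfl, (hT.isRegular_of_lt (by lia)).insert hkm le_rfl,
      ?_, ?_⟩
    · rw [monomialWeight_insert hmT, monomialWeight, monomialWeight]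
      linarith [pivotWeight_add_three_le m]
    · rw [P.lie_v_monomial_of_lt (fun i hi => by have := hTlt hi; lia), lie_swap_of_charTwo,
        P.lie_v_v_succ, P.xprod_mul_x_mul_v hmT]
  · left
    rw [P.lie_v_monomial_of_lt (fun i hi => by have := hTlt hi; lia), lie_self, mul_zero]
  · refine .inr ⟨insert n T, n + 3, by lia, (hT.isRegular_of_lt (by lia)).insert hkn le_rfl,
      ?_, ?_⟩
    · rw [monomialWeight_insert hnT, monomialWeight, monomialWeight]
      linarith [pivotWeight_add_three_le n]
    · rw [P.lie_v_monomial_of_lt (fun i hi => by have := hTlt hi; lia), P.lie_v_v_succ,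
        P.xprod_mul_x_mul_v hnT]
  · exact lie_v_monomial_mem_of_add_two_le hkn hnm hnT
      (lie_v_monomial_mem (by lia) hkm (by lia) hT)
termination_by m + 1 - n

theorem lie_monomial_mem {n m : ℕ} {S T : Finset ℕ} (hkn : k ≤ n) (hnm : n ≤ m)
    (hS : IsAdmissible k S n) (hT : IsAdmissible k T m) :
    ⁅P.monomial S n, P.monomial T m⁆ ∈ insert 0
      (P.regularMonomialsLE k (n + 2) (monomialWeight S n + monomialWeight T m)) := by
  have hST : Commute (P.xprod S) (P.monomial T m) :=
    (P.commute_xprod fun i hi => (P.commute_x_monomial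
      (by have := (hS.le hi).2; lia) T).symm).symm
  have hlie := xprod_mul_mem_regularMonomialsLE (hS.isRegular_of_lt (by lia))
    (lie_v_monomial_mem (P := P) hkn (hkn.trans hnm) (hnm.trans m.le_succ) hT)
  rwa [← mul_lie_of_commute hST, add_sub_right_comm] at hlie

theorem lie_mem_of_mem_monomialsLE (hkq : k ≤ q) {a b : A} (ha : a ∈ P.monomialsLE k q W)
    (hb : b ∈ P.monomialsLE k q W') :
    ⁅a, b⁆ ∈ insert 0 (P.monomialsLE k (q + 2) (W + W')) := by
  obtain ⟨S, n, hn, hS, hSW, rfl⟩ := ha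
  obtain ⟨T, m, hm, hT, hTW, rfl⟩ := hb
  have hsub {l : ℕ} (hl : q ≤ l) :
      P.regularMonomialsLE k (l + 2) (monomialWeight S n + monomialWeight T m)
        ⊆ P.monomialsLE k (q + 2) (W + W') :=
    (regularMonomialsLE_mono (by lia) (add_le_add hSW hTW)).trans
      regularMonomialsLE_subset_monomialsLE
  obtain hnm | hmn := le_total n m
  · exact Set.insert_subset_insert (hsub hn) (lie_monomial_mem (hkq.trans hn) hnm hS hT)
  · have hlie := lie_monomial_mem (P := P) (hkq.trans hm) hmn hT hS
    rw [lie_swap_of_charTwo, add_comm (monomialWeight T m)] at hlie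
    exact Set.insert_subset_insert (hsub hm) hlie

theorem sq_mem_of_mem_monomialsLE (hkq : k ≤ q) {a : A} (ha : a ∈ P.monomialsLE k q W) :
    a ^ 2 ∈ insert 0 (P.monomialsLE k (q + 2) (W + W)) := by
  obtain ⟨S, n, hn, hS, hSW, rfl⟩ := ha
  obtain rfl | hSne := S.eq_empty_or_nonempty
  · refine .inr ⟨{n + 1}, n + 3, by lia, .inr ⟨n + 1, by lia, rfl, rfl⟩, ?_, ?_⟩
    · rw [monomialWeight_empty] at hSW
      rw [monomialWeight, Finset.sum_singleton]
      linarith [pivotWeight_add_three_le n]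
    · rw [P.monomial_empty, P.v_sq, P.monomial_singleton]
  · exact .inl (P.monomial_sq_eq_zero hSne fun i hi => by have := (hS.le hi).2; lia)

end Products

variable {K A : Type*} [Field K] [Ring A] [Algebra K A] {P : PivotSystem A}

section Expansion

variable (K P) in
/-- The span of the admissible monomials `x^S v_n` of weight at most `W` in the letters `x_i`,
`i ≥ k`, with `n ≥ q`. -/
def spanLE (k q : ℕ) (W : ℚ) : Submodule K A := Submodule.span K (P.monomialsLE k q W)

variable {k q q' : ℕ} {W W' : ℚ}

theorem spanLE_mono (hq : q' ≤ q) (hW : W ≤ W') : P.spanLE K k q W ≤ P.spanLE K k q' W' :=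
  Submodule.span_mono (monomialsLE_mono hq hW)

theorem spanLE_eq_bot (hkq : k ≤ q) (hW : W < pivotWeight k) : P.spanLE K k q W = ⊥ := by
  rw [spanLE, Submodule.span_eq_bot]
  rintro _ ⟨S, n, hn, hS, hSW, rfl⟩
  exact absurd (hS.pivotWeight_le_monomialWeight (hkq.trans hn)) (hSW.trans_lt hW).not_ge

theorem commute_x_of_mem_spanLE {j : ℕ} (hj : j < q) {a : A} (ha : a ∈ P.spanLE K k q W) :
    Commute (P.x j) a := by
  refine commute_of_mem_span ?_ ha
  rintro _ ⟨S, n, hn, -, -, rfl⟩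
  exact P.commute_x_monomial (hj.trans_le hn) S

theorem commute_d_of_mem_spanLE {j : ℕ} (hjk : j < k) (hjq : j < q) {a : A}
    (ha : a ∈ P.spanLE K k q W) : Commute (P.d j) a := by
  refine commute_of_mem_span ?_ ha
  rintro _ ⟨S, n, hn, hS, -, rfl⟩
  exact P.commute_d_monomial (hjq.trans_le hn) fun hj => (hS.le hj).1.not_gt hjk

theorem exists_add_x_mul_of_mem_spanLE (hkq : k < q) {a : A} (ha : a ∈ P.spanLE K k q W) :
    ∃ b ∈ P.spanLE K (k + 1) (k + 1) W,
      ∃ c ∈ P.spanLE K (k + 1) (k + 2) (W + pivotWeight k), a = b + P.x k * c := by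
  have hle : P.spanLE K k q W ≤ P.spanLE K (k + 1) (k + 1) W ⊔
      (P.spanLE K (k + 1) (k + 2) (W + pivotWeight k)).map (LinearMap.mulLeft K (P.x k)) := by
    rw [spanLE, Submodule.span_le]
    rintro _ ⟨S, n, hn, hS, hSW, rfl⟩
    by_cases hk : k ∈ S
    · refine Submodule.mem_sup_right ⟨P.monomial (S.erase k) n, Submodule.subset_span
        ⟨S.erase k, n, (hS.le hk).2, .inl ((hS.isRegular_erase hk).succ_of_notMem
          (Finset.notMem_erase k S)), ?_, rfl⟩, (P.monomial_eq_x_mul_erase hk n).symm⟩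
      rw [monomialWeight_erase hk]
      exact add_le_add_left hSW _
    · exact Submodule.mem_sup_left (Submodule.subset_span
        ⟨S, n, hkq.trans_le hn, hS.succ_of_notMem hk, hSW, rfl⟩)
  obtain ⟨b, hb, _, ⟨c, hc, rfl⟩, rfl⟩ := Submodule.mem_sup.1 (hle ha)
  exact ⟨b, hb, c, hc, rfl⟩

theorem exists_smul_v_add_of_mem_spanLE {a : A} (ha : a ∈ P.spanLE K k k W) :
    ∃ t : K, ∃ b ∈ P.spanLE K k (k + 1) W, a = t • P.v k + b := by
  have hle : P.spanLE K k k W ≤ Submodule.span K {P.v k} ⊔ P.spanLE K k (k + 1) W := by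
    rw [spanLE, Submodule.span_le]
    rintro _ ⟨S, n, hn, hS, hSW, rfl⟩
    obtain rfl | hkn := hn.eq_or_lt
    · have hempty : S = ∅ :=
        Finset.eq_empty_of_forall_notMem fun i hi => by have := hS.le hi; lia
      rw [hempty, P.monomial_empty]
      exact Submodule.mem_sup_left (Submodule.mem_span_singleton_self _)
    · exact Submodule.mem_sup_right (Submodule.subset_span ⟨S, n, hkn, hS, hSW, rfl⟩)
  obtain ⟨_, hv, b, hb, rfl⟩ := Submodule.mem_sup.1 (hle ha)
  obtain ⟨t, rfl⟩ := Submodule.mem_span_singleton.1 hv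
  exact ⟨t, b, hb, rfl⟩

theorem exists_smul_d_add_of_mem_spanLE (hW : pivotWeight k ≤ W) {a : A}
    (ha : a ∈ P.spanLE K k k W) :
    ∃ t : K, ∃ b ∈ P.spanLE K (k + 1) (k + 1) W,
      ∃ c ∈ P.spanLE K (k + 1) (k + 2) (W + pivotWeight k), a = t • P.d k + b + P.x k * c := by
  obtain ⟨t, a', ha', rfl⟩ := exists_smul_v_add_of_mem_spanLE ha
  obtain ⟨b, hb, c, hc, rfl⟩ := exists_add_x_mul_of_mem_spanLE k.lt_succ_self ha'
  have htail : P.x (k + 1) * P.v (k + 3) ∈ P.spanLE K (k + 1) (k + 2) (W + pivotWeight k) := by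
    refine Submodule.subset_span ⟨{k + 1}, k + 3, Nat.le_succ _, .inr ⟨k + 1, le_rfl, rfl, rfl⟩, ?_,
      P.monomial_singleton _ _⟩
    rw [monomialWeight, Finset.sum_singleton]
    linarith [pivotWeight_add_three_le k]
  refine ⟨t, b, hb, _, add_mem (Submodule.smul_mem _ t htail) hc, ?_⟩
  rw [P.v_eq, smul_add, mul_add, mul_smul_comm]
  abel

end Expansion

section Nilpotency

variable [CharP A 2] {k q : ℕ} {W : ℚ}

theorem sq_mem_spanLE (hkq : k ≤ q) {a : A} (ha : a ∈ P.spanLE K k q W) :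
    a ^ 2 ∈ P.spanLE K k (q + 2) (W + W) :=
  sq_mem_of_mem_span
    (fun _ ha => mem_span_of_mem_insert_zero (sq_mem_of_mem_monomialsLE hkq ha))
    (fun _ ha _ hb => mem_span_of_mem_insert_zero (lie_mem_of_mem_monomialsLE hkq ha hb)) ha

theorem exists_sq_eq_add_x_mul (hW : pivotWeight k ≤ W) {a : A} (ha : a ∈ P.spanLE K k k W) :
    ∃ e ∈ P.spanLE K (k + 1) (k + 2) (W + W), ∃ f, Commute (P.x k) f ∧
      a ^ 2 = e + P.x k * f := by
  obtain ⟨t, b, hb, c, hc, rfl⟩ := exists_smul_d_add_of_mem_spanLE hW ha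
  have hxb := commute_x_of_mem_spanLE k.lt_succ_self hb
  have hxc := commute_x_of_mem_spanLE (j := k) (by lia) hc
  have hdb := (commute_d_of_mem_spanLE k.lt_succ_self k.lt_succ_self hb).smul_left t
  have hdc := (commute_d_of_mem_spanLE (j := k) (by lia) (by lia) hc).smul_left t
  have hd : (t • P.d k) ^ 2 = 0 := by rw [smul_pow, P.d_sq, smul_zero]
  refine ⟨t • c + b ^ 2, add_mem (Submodule.smul_mem _ t (spanLE_mono le_rfl ?_ hc))
    (spanLE_mono (by lia) le_rfl (sq_mem_spanLE le_rfl hb)), ⁅b, c⁆, ?_, ?_⟩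
  · linarith
  · exact (hxb.mul_right hxc).sub_right (hxc.mul_right hxb)
  · rw [add_add_mul_sq (P.x_mul_self k) hd hxb hdb hxc hdc, smul_lie, P.lie_d_x, smul_one_mul]

/-- Modulo the square-zero letters `x_k` and `x_{k+1}`, squaring doubles `W` and raises `k` by
two, so that `W / pivotWeight k` decreases by the factor `9 / 8`. -/
theorem isNilpotent_of_mem_spanLE (N : ℕ) (hW : W < pivotWeight k * (9 / 8) ^ N) {a : A}
    (ha : a ∈ P.spanLE K k k W) : IsNilpotent a := by
  induction N generalizing k W a with
  | zero =>
    rw [spanLE_eq_bot le_rfl (by simpa using hW), Submodule.mem_bot] at ha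
    exact ha ▸ IsNilpotent.zero
  | succ N ih =>
    obtain hWk | hkW := lt_or_ge W (pivotWeight k)
    · rw [spanLE_eq_bot le_rfl hWk, Submodule.mem_bot] at ha
      exact ha ▸ IsNilpotent.zero
    obtain ⟨e, he, f, hf, ha_sq⟩ := exists_sq_eq_add_x_mul hkW ha
    obtain ⟨b, hb, c, hc, rfl⟩ := exists_add_x_mul_of_mem_spanLE (Nat.lt_succ_self _) he
    have hW' : W + W < pivotWeight (k + 2) * (9 / 8) ^ N := by
      rw [pivotWeight_succ, pivotWeight_succ]
      rw [pow_succ] at hW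
      linarith
    have hbc : IsNilpotent (b + P.x (k + 1) * c) :=
      isNilpotent_add_mul (P.x_mul_self _) (commute_x_of_mem_spanLE (Nat.lt_succ_self _) hb)
        (commute_x_of_mem_spanLE (by lia) hc) (ih hW' hb)
    refine IsNilpotent.of_pow (m := 2) ?_
    rw [ha_sq]
    exact isNilpotent_add_mul (P.x_mul_self k) (commute_x_of_mem_spanLE (by lia) he) hf hbc

variable (P) in
/-- The admissible monomials `x^S v_n`. -/
def monomials : Set A := ⋃ W, P.monomialsLE 0 0 W

theorem lie_mem_monomials {a b : A} (ha : a ∈ P.monomials) (hb : b ∈ P.monomials) :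
    ⁅a, b⁆ ∈ insert 0 P.monomials := by
  obtain ⟨W, ha⟩ := Set.mem_iUnion.1 ha
  obtain ⟨W', hb⟩ := Set.mem_iUnion.1 hb
  exact Set.insert_subset_insert
    ((monomialsLE_mono (Nat.zero_le _) le_rfl).trans (Set.subset_iUnion _ _))
    (lie_mem_of_mem_monomialsLE le_rfl ha hb)

theorem sq_mem_monomials {a : A} (ha : a ∈ P.monomials) : a ^ 2 ∈ insert 0 P.monomials := by
  obtain ⟨W, ha⟩ := Set.mem_iUnion.1 ha
  exact Set.insert_subset_insert
    ((monomialsLE_mono (Nat.zero_le _) le_rfl).trans (Set.subset_iUnion _ _))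
    (sq_mem_of_mem_monomialsLE le_rfl ha)

theorem isNilpotent_of_mem_span_monomials {a : A} (ha : a ∈ Submodule.span K P.monomials) :
    IsNilpotent a := by
  have hdir : Directed (· ≤ ·) (P.spanLE K 0 0) :=
    Monotone.directed_le fun _ _ hW => spanLE_mono le_rfl hW
  rw [monomials, Submodule.span_iUnion] at ha
  obtain ⟨W, ha⟩ := (Submodule.mem_iSup_of_directed _ hdir).1 ha
  obtain ⟨N, hN⟩ := pow_unbounded_of_one_lt W (show (1 : ℚ) < 9 / 8 by norm_num)
  exact isNilpotent_of_mem_spanLE N (by simpa [pivotWeight] using hN) ha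

end Nilpotency

end PivotSystem

section GrassmannPivots

variable {K : Type*} [Field K]

theorem gx_mul_self (i : ℕ) : gx K i * gx K i = 0 :=
  ExteriorAlgebra.ι_sq_zero _

theorem gd_ι_mul (i : ℕ) (m : ℕ →₀ K) (f : Grassmann K) :
    gd K i (ExteriorAlgebra.ι K m * f) = m i • f - ExteriorAlgebra.ι K m * gd K i f :=
  CliffordAlgebra.contractLeft_ι_mul _ _ _

theorem gd_gx_mul_self (i : ℕ) (f : Grassmann K) :
    gd K i (gx K i * f) = f - gx K i * gd K i f := by
  rw [gx, gd_ι_mul, Finsupp.single_eq_same, one_smul]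

theorem gd_gx_mul_of_ne {i j : ℕ} (hij : i ≠ j) (f : Grassmann K) :
    gd K i (gx K j * f) = -(gx K j * gd K i f) := by
  rw [gx, gd_ι_mul, Finsupp.single_eq_of_ne hij, zero_smul, zero_sub]

theorem gd_gd_comm (i j : ℕ) (f : Grassmann K) : gd K i (gd K j f) = -gd K j (gd K i f) :=
  CliffordAlgebra.contractLeft_comm _ _ _

theorem gd_pivotCoeff_mul {i j : ℕ} (hji : j < i) (l : ℕ) (f : Grassmann K) :
    gd K j (pivotCoeff K i l * f) = pivotCoeff K i l * gd K j f := by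
  induction l generalizing f with
  | zero => simp [pivotCoeff]
  | succ l ih =>
    rw [pivotCoeff, mul_assoc, ih, mul_assoc, gd_gx_mul_of_ne (by lia),
      gd_gx_mul_of_ne (by lia), mul_neg, mul_neg, mul_neg, neg_neg, mul_assoc, mul_assoc]

theorem pivotCoeff_succ_left (i l : ℕ) :
    pivotCoeff K i (l + 1) = gx K i * gx K (i + 1) * pivotCoeff K (i + 3) l := by
  induction l with
  | zero => simp [pivotCoeff]
  | succ l ih =>
    rw [pivotCoeff, ih, pivotCoeff, mul_assoc _ (pivotCoeff K (i + 3) l),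
      show i + 3 * (l + 1) = i + 3 + 3 * l by ring]

theorem pivot_apply (i : ℕ) (f : Grassmann K) :
    pivot K i f = ∑ᶠ l : ℕ, pivotCoeff K i l * gd K (i + 3 * l) f := rfl

theorem pivot_apply_eq (i : ℕ) (f : Grassmann K) :
    pivot K i f = gd K i f + gx K i * (gx K (i + 1) * pivot K (i + 3) f) := by
  obtain ⟨N, hN⟩ := ((finite_pivot_support K i f).union (finite_pivot_support K (i + 3) f)).bddAbove
  have hsum (j M : ℕ) (hM : Function.support (fun l => pivotCoeff K j l * gd K (j + 3 * l) f)
      ⊆ Set.Iio M) :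
      pivot K j f = ∑ l ∈ Finset.range M, pivotCoeff K j l * gd K (j + 3 * l) f :=
    finsum_eq_sum_of_support_subset _ (by rwa [Finset.coe_range])
  rw [hsum i (N + 2) fun l hl => Set.mem_Iio.2 (by have := hN (.inl hl); lia),
    hsum (i + 3) (N + 1) fun l hl => Set.mem_Iio.2 (by have := hN (.inr hl); lia),
    Finset.sum_range_succ', Finset.mul_sum, Finset.mul_sum, add_comm]
  congr 1
  · simp [pivotCoeff]
  · refine Finset.sum_congr rfl fun l _ => ?_
    rw [pivotCoeff_succ_left, show i + 3 * (l + 1) = i + 3 + 3 * l by ring, mul_assoc, mul_assoc]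

variable [CharP K 2]

instance charP_grassmann : CharP (Grassmann K) 2 :=
  charP_of_injective_algebraMap (algebraMap K (Grassmann K)).injective 2

instance charP_end_grassmann : CharP (Module.End K (Grassmann K)) 2 :=
  charP_of_injective_algebraMap (algebraMap K (Module.End K (Grassmann K))).injective 2

theorem commute_gx_gx (i j : ℕ) : Commute (gx K i) (gx K j) := by
  have hswap := ExteriorAlgebra.ι_add_mul_swap (R := K) (Finsupp.single i (1 : K))
    (Finsupp.single j (1 : K))
  rwa [CharTwo.add_eq_zero] at hswap

theorem commute_gx_pivotCoeff (j i l : ℕ) : Commute (gx K j) (pivotCoeff K i l) := by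
  induction l with
  | zero => exact Commute.one_right _
  | succ l ih => exact ih.mul_right ((commute_gx_gx j _).mul_right (commute_gx_gx j _))

theorem gx_mul_pivot {j i : ℕ} (hji : j < i) (f : Grassmann K) :
    gx K j * pivot K i f = pivot K i (gx K j * f) := by
  rw [pivot_apply, pivot_apply, ← LinearMap.mulLeft_apply (R := K),
    map_finsum _ (finite_pivot_support K i f)]
  refine finsum_congr fun l => ?_
  rw [LinearMap.mulLeft_apply, gd_gx_mul_of_ne (by lia), CharTwo.neg_eq,
    (commute_gx_pivotCoeff j i l).left_comm]

theorem gd_pivot {j i : ℕ} (hji : j < i) (f : Grassmann K) :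
    gd K j (pivot K i f) = pivot K i (gd K j f) := by
  rw [pivot_apply, pivot_apply, map_finsum _ (finite_pivot_support K i f)]
  refine finsum_congr fun l => ?_
  rw [gd_pivotCoeff_mul hji, gd_gd_comm, CharTwo.neg_eq]

variable (K) in
/-- The letters, acting by left multiplication, the superderivatives and the pivots of the
Grassmann algebra in characteristic two. -/
noncomputable def grassmannPivotSystem : PivotSystem (Module.End K (Grassmann K)) where
  x i := LinearMap.mulLeft K (gx K i)
  d := gd K
  v := pivot K
  commute_x_x i j := LinearMap.ext fun f => (commute_gx_gx i j).left_comm f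
  x_mul_self i := LinearMap.ext fun f => by
    rw [Module.End.mul_apply, LinearMap.mulLeft_apply, LinearMap.mulLeft_apply, ← mul_assoc,
      gx_mul_self, zero_mul, LinearMap.zero_apply]
  d_sq i := (sq (gd K i)).trans
    (LinearMap.ext fun f => CliffordAlgebra.contractLeft_contractLeft _ f)
  lie_d_x i := LinearMap.ext fun f => by
    rw [LieRing.of_associative_ring_bracket, LinearMap.sub_apply, Module.End.mul_apply,
      Module.End.mul_apply, LinearMap.mulLeft_apply, LinearMap.mulLeft_apply, gd_gx_mul_self,
      CharTwo.sub_eq_add, CharTwo.sub_eq_add, CharTwo.add_cancel_right, Module.End.one_apply]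
  commute_d_x hij := LinearMap.ext fun f => (gd_gx_mul_of_ne hij f).trans (CharTwo.neg_eq _)
  v_eq i := LinearMap.ext (pivot_apply_eq i)
  commute_x_v hin := LinearMap.ext (gx_mul_pivot hin)
  commute_d_v hin := LinearMap.ext (gd_pivot hin)

end GrassmannPivots

section Parity

variable {K : Type*} [Field K]

theorem gx_mem_gParity (i : ℕ) : gx K i ∈ gParity K 1 :=
  CliffordAlgebra.ι_mem_evenOdd_one _ _

theorem mul_mem_gParity {α β : ZMod 2} {f g : Grassmann K} (hf : f ∈ gParity K α)
    (hg : g ∈ gParity K β) : f * g ∈ gParity K (α + β) :=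
  CliffordAlgebra.evenOdd_mul_le _ α β (Submodule.mul_mem_mul hf hg)

theorem gd_mem_gParity_of_mem_exteriorPower (i n : ℕ) {f : Grassmann K}
    (hf : f ∈ ⋀[K]^n (ℕ →₀ K)) : gd K i f ∈ gParity K (1 + n) := by
  induction hf using Submodule.pow_induction_on_left' with
  | algebraMap r =>
    rw [gd, CliffordAlgebra.contractLeft_algebraMap]
    exact zero_mem _
  | add f g n _ _ hf hg =>
    rw [map_add]
    exact add_mem hf hg
  | mem_mul m hm n f hf ih =>
    obtain ⟨m, rfl⟩ := hm
    have hparity : (1 + (n + 1 : ℕ) : ZMod 2) = n := by grind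
    have hι : ExteriorAlgebra.ι K m ∈ gParity K 1 := CliffordAlgebra.ι_mem_evenOdd_one _ m
    have hle : ⋀[K]^n (ℕ →₀ K) ≤ gParity K (n : ZMod 2) :=
      le_iSup_of_le (⟨n, rfl⟩ : {j : ℕ // (j : ZMod 2) = n}) le_rfl
    rw [gd_ι_mul, hparity]
    refine sub_mem (Submodule.smul_mem _ _ (hle hf)) ?_
    simpa only [← add_assoc, CharTwo.add_self_eq_zero, zero_add] using mul_mem_gParity hι ih

theorem gd_mem_gParity (i : ℕ) {α : ZMod 2} {f : Grassmann K} (hf : f ∈ gParity K α) :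
    gd K i f ∈ gParity K (1 + α) := by
  have hle : gParity K α ≤ (gParity K (1 + α)).comap (gd K i) := by
    refine iSup_le ?_
    rintro ⟨n, rfl⟩ f hf
    exact gd_mem_gParity_of_mem_exteriorPower i n hf
  exact hle hf

theorem pivotCoeff_mem_gParity (i l : ℕ) : pivotCoeff K i l ∈ gParity K 0 := by
  induction l with
  | zero => exact SetLike.GradedOne.one_mem (A := CliffordAlgebra.evenOdd _)
  | succ l ih =>
    simpa only [pivotCoeff, zero_add, CharTwo.add_self_eq_zero] using
      mul_mem_gParity ih (mul_mem_gParity (gx_mem_gParity (i + 3 * l))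
        (gx_mem_gParity (i + 3 * l + 1)))

theorem pivot_mem_endParity (i : ℕ) : pivot K i ∈ endParity K 1 := by
  intro α f hf
  rw [pivot_apply]
  refine finsum_induction (· ∈ gParity K (1 + α)) (zero_mem _) (fun _ _ => add_mem) fun l => ?_
  simpa only [zero_add] using
    mul_mem_gParity (pivotCoeff_mem_gParity i l) (gd_mem_gParity (i + 3 * l) hf)

theorem mulLeft_gx_mem_endParity (i : ℕ) : LinearMap.mulLeft K (gx K i) ∈ endParity K 1 :=
  fun _ _ hf => mul_mem_gParity (gx_mem_gParity i) hf

theorem mul_mem_endParity {α β : ZMod 2} {φ ψ : Module.End K (Grassmann K)}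
    (hφ : φ ∈ endParity K α) (hψ : ψ ∈ endParity K β) : φ * ψ ∈ endParity K (α + β) :=
  fun γ f hf => by
    rw [add_assoc]
    exact hφ _ _ (hψ γ f hf)

theorem exists_monomial_mem_endParity [CharP K 2] (S : Finset ℕ) (n : ℕ) :
    ∃ α, (grassmannPivotSystem K).monomial S n ∈ endParity K α := by
  induction S using Finset.induction_on with
  | empty => exact ⟨1, by rw [PivotSystem.monomial_empty]; exact pivot_mem_endParity n⟩
  | insert i S hi ih =>
    obtain ⟨α, hα⟩ := ih
    rw [PivotSystem.monomial_insert _ hi]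
    exact ⟨1 + α, mul_mem_endParity (mulLeft_gx_mem_endParity i) hα⟩

end Parity

section LieSuperClosure

variable {K : Type*} [Field K] {X : Set (Module.End K (Grassmann K))}
  {a b : Module.End K (Grassmann K)}

theorem subset_lieSuperClosure (X : Set (Module.End K (Grassmann K))) :
    X ⊆ (lieSuperClosure K X : Set (Module.End K (Grassmann K))) := fun _ ha =>
  Submodule.mem_sInf.2 fun _ hS => hS.1 ha

theorem sq_mem_lieSuperClosure (hodd : a ∈ endParity K 1) (ha : a ∈ lieSuperClosure K X) :
    a ^ 2 ∈ lieSuperClosure K X :=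
  Submodule.mem_sInf.2 fun S hS => hS.2.sq_mem a ⟨Submodule.mem_sInf.1 ha S hS, hodd⟩

theorem exists_add_mem_endParity_of_mem_span {B : Set (Module.End K (Grassmann K))}
    {S : Submodule K (Module.End K (Grassmann K))} (hB : ∀ a ∈ B, ∃ α, a ∈ endParity K α)
    (ha : a ∈ Submodule.span K (B ∩ S)) :
    ∃ a₀ ∈ S ⊓ endParity K 0, ∃ a₁ ∈ S ⊓ endParity K 1, a = a₀ + a₁ := by
  have hle : Submodule.span K (B ∩ S) ≤ (S ⊓ endParity K 0) ⊔ (S ⊓ endParity K 1) := by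
    refine Submodule.span_le.2 fun a ha => ?_
    obtain ⟨α, hα⟩ := hB a ha.1
    obtain rfl | rfl : α = 0 ∨ α = 1 := by clear hα; revert α; decide
    · exact Submodule.mem_sup_left ⟨ha.2, hα⟩
    · exact Submodule.mem_sup_right ⟨ha.2, hα⟩
  obtain ⟨a₀, ha₀, a₁, ha₁, rfl⟩ := Submodule.mem_sup.1 (hle ha)
  exact ⟨a₀, ha₀, a₁, ha₁, rfl⟩

variable [CharP K 2]

theorem superbracket_eq_lie (m : ℕ) (a b : Module.End K (Grassmann K)) :
    a * b - (-1 : K) ^ m • (b * a) = ⁅a, b⁆ := by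
  rw [CharTwo.neg_eq, one_pow, one_smul, LieRing.of_associative_ring_bracket]

theorem lie_mem_lieSuperClosure {α β : ZMod 2} (hα : a ∈ endParity K α) (hβ : b ∈ endParity K β)
    (ha : a ∈ lieSuperClosure K X) (hb : b ∈ lieSuperClosure K X) :
    ⁅a, b⁆ ∈ lieSuperClosure K X :=
  Submodule.mem_sInf.2 fun S hS => superbracket_eq_lie (α.val * β.val) a b ▸
    hS.2.bracket_mem α β a ⟨Submodule.mem_sInf.1 ha S hS, hα⟩ b ⟨Submodule.mem_sInf.1 hb S hS, hβ⟩

theorem exists_mem_endParity_of_mem_monomials (ha : a ∈ (grassmannPivotSystem K).monomials) :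
    ∃ α, a ∈ endParity K α := by
  obtain ⟨_, S, n, -, -, -, rfl⟩ := Set.mem_iUnion.1 ha
  exact exists_monomial_mem_endParity S n

theorem isLieSuperSubalgebra_restrictedLieClosure (hX : X ⊆ (grassmannPivotSystem K).monomials) :
    IsLieSuperSubalgebra K (restrictedLieClosure K 2 X).toSubmodule where
  graded _ ha := exists_add_mem_endParity_of_mem_span
    (fun _ => exists_mem_endParity_of_mem_monomials)
    (restrictedLieClosure_le_span_inter hX (subset_restrictedLieClosure 2 X)
      (fun _ ha _ hb => PivotSystem.lie_mem_monomials ha hb)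
      (fun _ ha => PivotSystem.sq_mem_monomials ha)
      (fun _ ha _ hb => (restrictedLieClosure K 2 X).lie_mem ha.2 hb.2)
      (fun _ ha => pow_mem_restrictedLieClosure K 2 X ha.2) ha)
  bracket_mem _ _ a ha b hb :=
    (superbracket_eq_lie _ a b).symm ▸ (restrictedLieClosure K 2 X).lie_mem ha.1 hb.1
  sq_mem _ ha := pow_mem_restrictedLieClosure K 2 X ha.1

theorem sq_mem_lieSuperClosure_of_mem_monomials (ha : a ∈ (grassmannPivotSystem K).monomials)
    (haX : a ∈ lieSuperClosure K X) : a ^ 2 ∈ lieSuperClosure K X := by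
  obtain ⟨_, S, n, -, hS, -, rfl⟩ := Set.mem_iUnion.1 ha
  obtain rfl | hSne := S.eq_empty_or_nonempty
  · refine sq_mem_lieSuperClosure ?_ haX
    rw [PivotSystem.monomial_empty]
    exact pivot_mem_endParity n
  · rw [PivotSystem.monomial_sq_eq_zero _ hSne fun i hi => by have := (hS.le hi).2; lia]
    exact zero_mem _

theorem restrictedLieClosure_le_lieSuperClosure (hX : X ⊆ (grassmannPivotSystem K).monomials) :
    (restrictedLieClosure K 2 X).toSubmodule ≤ lieSuperClosure K X := by
  refine (restrictedLieClosure_le_span_inter (S := lieSuperClosure K X) hX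
    (subset_lieSuperClosure X) (fun _ ha _ hb => PivotSystem.lie_mem_monomials ha hb)
    (fun _ ha => PivotSystem.sq_mem_monomials ha) (fun a ha b hb => ?_)
    fun a ha => sq_mem_lieSuperClosure_of_mem_monomials ha.1 ha.2).trans
    (Submodule.span_le.2 Set.inter_subset_right)
  obtain ⟨α, hα⟩ := exists_mem_endParity_of_mem_monomials ha.1
  obtain ⟨β, hβ⟩ := exists_mem_endParity_of_mem_monomials hb.1
  exact lie_mem_lieSuperClosure hα hβ ha.2 hb.2

theorem lieSuperClosure_eq_restrictedLieClosure (hX : X ⊆ (grassmannPivotSystem K).monomials) :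
    lieSuperClosure K X = (restrictedLieClosure K 2 X).toSubmodule :=
  le_antisymm
    (sInf_le ⟨subset_restrictedLieClosure 2 X, isLieSuperSubalgebra_restrictedLieClosure hX⟩)
    (restrictedLieClosure_le_lieSuperClosure hX)

theorem isNilpotent_of_mem_restrictedLieClosure (hX : X ⊆ (grassmannPivotSystem K).monomials)
    (ha : a ∈ restrictedLieClosure K 2 X) : IsNilpotent a :=
  PivotSystem.isNilpotent_of_mem_span_monomials (restrictedLieClosure_le_span hX
    (fun _ ha _ hb => mem_span_of_mem_insert_zero (PivotSystem.lie_mem_monomials ha hb))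
    (fun _ ha => mem_span_of_mem_insert_zero (PivotSystem.sq_mem_monomials ha)) ha)

variable (K) in
theorem generators_subset_monomials : generators K ⊆ (grassmannPivotSystem K).monomials := by
  have v_mem (n : ℕ) : pivot K n ∈ (grassmannPivotSystem K).monomials :=
    Set.mem_iUnion.2 ⟨monomialWeight ∅ n, ∅, n, n.zero_le, .inl (isRegular_empty 0 n), le_rfl,
      PivotSystem.monomial_empty _ n⟩
  rintro a (rfl | rfl | rfl) <;> exact v_mem _

end LieSuperClosure

end FractalLie

open FractalLie in
theorem mainTheorem10_general (K : Type*) [Field K] [CharP K 2]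
    {X : Set (Module.End K (Grassmann K))} (hX : X ⊆ (grassmannPivotSystem K).monomials) :
    lieSuperClosure K X = (restrictedLieClosure K 2 X).toSubmodule ∧
    IsPMapping K (restrictedLieClosure K 2 X) 2 (restrictedLieClosurePMap K 2 X) ∧
    IsNilPMapping (restrictedLieClosurePMap K 2 X) :=
  ⟨lieSuperClosure_eq_restrictedLieClosure hX, isPMapping_restrictedLieClosurePMap_two X,
    isNilPMapping_of_isNilpotent one_lt_two fun _ => isNilpotent_of_mem_restrictedLieClosure hX⟩

theorem mainTheorem10 (K : Type*) [Field K] [CharP K 2] :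
    FractalLie.Q K = (FractalLie.restrictedLieClosure K 2 (FractalLie.generators K)).toSubmodule ∧
    FractalLie.IsPMapping K (FractalLie.restrictedLieClosure K 2 (FractalLie.generators K)) 2
      (FractalLie.restrictedLieClosurePMap K 2 (FractalLie.generators K)) ∧
    FractalLie.IsNilPMapping
      (FractalLie.restrictedLieClosurePMap K 2 (FractalLie.generators K)) :=
  mainTheorem10_general K (FractalLie.generators_subset_monomials K)
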